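/- Theorem 2.1 (Comparison Theorem). Let $H:\mathbb R^n\to\mathbb R$ be convex with $H(0)=\min_{\mathbb R^n} H=0$, and suppose that the set $\{p: H(p)=0\}$ is bounded and has empty interior. Let $U\subset\mathbb R^n$ be bounded and open. For open sets $V$ and $U$, write $V\ll U$ if $\overline V$ is a compact subset of $U$; let $\mathrm{Lip}_{\mathrm{loc}}(U)$ be the set of functions $u:U\to\mathbb R$ that are Lipschitz continuous on every open $V\ll U$; and for $v\in\mathrm{Lip}_{\mathrm{loc}}(V)$ (which is differentiable almost everywhere in $V$) put $\|H(Dv)\|_{L^\infty(V)}:=\operatorname{ess\,sup}_{x\in V}H(Dv(x))\le\infty$. A function $u\in\mathrm{Lip}_{\mathrm{loc}}(U)$ is *absolutely minimizing for $H$ in $U$* if $$\|H(Du)\|_{L^\infty(V)}\le\|H(Dv)\|_{L^\infty(V)}$$ whenever $V\ll U$ is open and $v\in\mathrm{Lip}_{\mathrm{loc}}(V)\cap C(\overline V)$ satisfies $v=u$ on $\partial V$. It is *absolutely subminimizing* (respectively, *absolutely superminimizing*) *for $H$ in $U$* if this inequality holds for all such $V$ and $v$ that satisfy in addition $v\le u$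 in $V$ (respectively, $v\ge u$ in $V$). (a) If $u,v\in C(\overline U)$, $u$ is absolutely subminimizing for $H$ in $U$ and $v$ is absolutely superminimizing for $H$ in $U$, then $$u(x)-v(x)\le\max_{y\in\partial U}\bigl(u(y)-v(y)\bigr)\qquad\text{for every }x\in U.$$ (b) Consequently, absolutely minimizing functions are uniquely determined by their boundary values: if $u,v\in C(\overline U)$ are both absolutely minimizing for $H$ in $U$ and $u=v$ on $\partial U$, then $u=v$ on $\overline U$. -/

import Mathlib

open MeasureTheory Set

noncomputable section

/-- `V ≪ U` for open sets: the closure of `V` is a compact subset of `U`. -/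
def CompactlyInside {n : ℕ} (V U : Set (EuclideanSpace ℝ (Fin n))) : Prop :=
  IsOpen V ∧ IsCompact (closure V) ∧ closure V ⊆ U

/-- `u ∈ Lip_loc(U)`: `u` is Lipschitz continuous on every open `V ≪ U`.
Only the values of `u` on `U` matter. -/
def LipLoc {n : ℕ} (U : Set (EuclideanSpace ℝ (Fin n)))
    (u : EuclideanSpace ℝ (Fin n) → ℝ) : Prop :=
  ∀ V : Set (EuclideanSpace ℝ (Fin n)), CompactlyInside V U →
    ∃ K : NNReal, LipschitzOnWith K u V

/-- `‖H(Du)‖_{L^∞(V)} = ess sup_{x ∈ V} H(Du(x))`, possibly `+∞`.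
It is used only for `V` open and `u ∈ Lip_loc(V)`: then `u` is differentiable at almost every
point of `V`, and at a point of `V` the gradient depends only on `u` near that point. -/
def supH {n : ℕ} (H : EuclideanSpace ℝ (Fin n) → ℝ) (V : Set (EuclideanSpace ℝ (Fin n)))
    (u : EuclideanSpace ℝ (Fin n) → ℝ) : EReal :=
  essSup (fun x => ((H (gradient u x) : ℝ) : EReal)) (volume.restrict V)

/-- `v` competes with `u` on `V`: `v ∈ Lip_loc(V) ∩ C(closure V)` and `v = u` on `∂V`. -/
def Competitor {n : ℕ} (V : Set (EuclideanSpace ℝ (Fin n)))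
    (u v : EuclideanSpace ℝ (Fin n) → ℝ) : Prop :=
  LipLoc V v ∧ ContinuousOn v (closure V) ∧ EqOn v u (frontier V)

/-- `u` is absolutely minimizing for `H` in `U`. -/
def AbsMinimizing {n : ℕ} (H : EuclideanSpace ℝ (Fin n) → ℝ)
    (U : Set (EuclideanSpace ℝ (Fin n))) (u : EuclideanSpace ℝ (Fin n) → ℝ) : Prop :=
  LipLoc U u ∧ ∀ V, CompactlyInside V U → ∀ v, Competitor V u v → supH H V u ≤ supH H V v

/-- `u` is absolutely subminimizing for `H` in `U`: only competitors `v ≤ u` are considered. -/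
def AbsSubminimizing {n : ℕ} (H : EuclideanSpace ℝ (Fin n) → ℝ)
    (U : Set (EuclideanSpace ℝ (Fin n))) (u : EuclideanSpace ℝ (Fin n) → ℝ) : Prop :=
  LipLoc U u ∧ ∀ V, CompactlyInside V U → ∀ v, Competitor V u v →
    (∀ x ∈ V, v x ≤ u x) → supH H V u ≤ supH H V v

/-- `u` is absolutely superminimizing for `H` in `U`: only competitors `v ≥ u` are considered. -/
def AbsSuperminimizing {n : ℕ} (H : EuclideanSpace ℝ (Fin n) → ℝ)
    (U : Set (EuclideanSpace ℝ (Fin n))) (u : EuclideanSpace ℝ (Fin n) → ℝ) : Prop :=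
  LipLoc U u ∧ ∀ V, CompactlyInside V U → ∀ v, Competitor V u v →
    (∀ x ∈ V, u x ≤ v x) → supH H V u ≤ supH H V v

end

noncomputable section

open Filter Topology

/-! Subminimality of `u` gives comparison from above with cones, the support functions of `{H ≤ s}`:
where `u` exceeds such a cone, the cone competes with `u`, so `H(Du) ≤ s` a.e. there, and
integrating `Du` along a ray through the vertex rules out the excess.

Uniqueness is then a discrete matter. Let a displacement `w` cost `t L(w/t)`, with `L` the Legendre
transform of `H` truncated to `{H ≤ S}`. The sup-convolution `f` of `u` with this cost satisfies the
finite-difference inequality `loss ≤ gain` for steps of length at most `ρ`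
(`ComparisonWithCones.loss_supConv_le_gain`). By the reflection `H(p) ↦ H(-p)`, `v ↦ -v`, the
inf-convolution `g` of `v` satisfies `gain ≤ loss`. Both are uniformly close to `u` and `v` for
small `ρ`.

If the gain of `f` is at least `γ > 0`, comparison is elementary: from a near-maximum of `f - g`, a
step of nearly maximal gain keeps `f - g` nearly maximal and raises `f` by a fixed amount, which
cannot go on forever. In general `exists_patch` first lowers `f` to reach such a gain, by about the
round-trip cost of leaving the domain. This cost is where the empty interior enters: the convex set
`{H = 0}` lies in a hyperplane with normal `e`, so short steps along `±e` are cheap relative to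
their length, and `U` can be crossed at arbitrarily small total cost. -/

/-- The largest net gain `f y - f x - c x y` over the neighbours `y` of `x`. -/
def gain {X : Type*} (N : X → X → Prop) (c : X → X → ℝ) (f : X → ℝ) (x : X) : ℝ :=
  ⨆ y : {y // N x y}, (f y - f x - c x y)

/-- The largest value of `f x - f z - c z x` over the neighbours `z` of `x`. -/
def loss {X : Type*} (N : X → X → Prop) (c : X → X → ℝ) (f : X → ℝ) (x : X) : ℝ :=
  gain N (fun x y => c y x) (fun x => -f x) x

/-! ### Discrete comparison on a graph with step costs -/

section Discrete

variable {X : Type*} {N : X → X → Prop} {c : X → X → ℝ} {f g : X → ℝ}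

lemma le_gain (hc : ∀ x y, 0 ≤ c x y) {B : ℝ} (hf : ∀ x, |f x| ≤ B) {x y : X} (h : N x y) :
    f y - f x - c x y ≤ gain N c f x := by
  refine le_ciSup (f := fun y : {y // N x y} => f y - f x - c x y) ⟨2 * B, ?_⟩ ⟨y, h⟩
  rintro _ ⟨z, rfl⟩
  have h1 := abs_le.1 (hf z)
  have h2 := abs_le.1 (hf x)
  have h3 := hc x z
  simp only
  linarith

lemma gain_le (hN : ∀ x, N x x) {x : X} {s : ℝ} (h : ∀ y, N x y → f y - f x - c x y ≤ s) :
    gain N c f x ≤ s :=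
  have : Nonempty {y // N x y} := ⟨⟨x, hN x⟩⟩
  ciSup_le fun y => h y y.2

lemma exists_lt_of_lt_gain (hN : ∀ x, N x x) {x : X} {s : ℝ} (h : s < gain N c f x) :
    ∃ y, N x y ∧ s < f y - f x - c x y := by
  by_contra! hcon
  exact absurd (gain_le hN hcon) (not_le.2 h)

lemma le_loss (hc : ∀ x y, 0 ≤ c x y) {B : ℝ} (hf : ∀ x, |f x| ≤ B) {x z : X} (h : N x z) :
    f x - f z - c z x ≤ loss N c f x := by
  have := le_gain (c := fun x y => c y x) (f := fun x => -f x) (fun x y => hc y x)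
    (B := B) (by simpa using hf) h
  unfold loss
  linarith

lemma loss_le (hN : ∀ x, N x x) {x : X} {s : ℝ} (h : ∀ z, N x z → f x - f z - c z x ≤ s) :
    loss N c f x ≤ s :=
  gain_le hN fun y hy => by linarith [h y hy]

/-- Discrete comparison when the gain of the subsolution is bounded away from zero. -/
lemma discrete_comparison_of_gain_ge (hN : ∀ x, N x x) (hc : ∀ x y, 0 ≤ c x y)
    {B : ℝ} (hf : ∀ x, |f x| ≤ B) (hg : ∀ x, |g x| ≤ B) {D : Set X}
    (hfD : ∀ x ∈ D, loss N c f x ≤ gain N c f x)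
    (hgD : ∀ x ∈ D, gain N c g x ≤ loss N c g x)
    {γ : ℝ} (hγ : 0 < γ) (hgain : ∀ x ∈ D, γ ≤ gain N c f x)
    {M : ℝ} (hM : ∀ x ∉ D, f x - g x ≤ M) (x : X) : f x - g x ≤ M := by
  by_contra! hx
  have hbd : BddAbove (range fun x => f x - g x) := by
    refine ⟨2 * B, ?_⟩
    rintro _ ⟨z, rfl⟩
    have h1 := abs_le.1 (hf z)
    have h2 := abs_le.1 (hg z)
    simp only
    linarith
  set S := ⨆ x, (f x - g x) with hS
  have hleS : ∀ z, f z - g z ≤ S := fun z => le_ciSup hbd z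
  have hMS : M < S := hx.trans_le (hleS x)
  -- Induction along steps of nearly maximal gain: `f - g` stays near its supremum, while each step
  -- raises `f` by at least `γ / 2`. Boundedness of `f` then gives the contradiction.
  have key : ∀ j : ℕ, ∀ η > 0, ∃ z, S - η < f z - g z ∧ -B + j * (γ / 2) ≤ f z := by
    intro j
    induction j with
    | zero =>
      intro η hη
      have : Nonempty X := ⟨x⟩
      obtain ⟨z, hz⟩ := exists_lt_of_lt_ciSup (show S - η < ⨆ x, (f x - g x) by rw [← hS]; linarith)
      exact ⟨z, hz, by simpa using (abs_le.1 (hf z)).1⟩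
    | succ j ih =>
      intro η hη
      obtain ⟨η', hη', h1, h2, h3⟩ : ∃ η' > 0, 3 * η' ≤ η ∧ η' ≤ S - M ∧ η' ≤ γ / 2 := by
        refine ⟨min (η / 3) (min (S - M) (γ / 2)), ?_, ?_, ?_, ?_⟩
        · exact lt_min (by linarith) (lt_min (by linarith) (by linarith))
        · linarith [min_le_left (η / 3) (min (S - M) (γ / 2))]
        · exact (min_le_right _ _).trans (min_le_left _ _)
        · exact (min_le_right _ _).trans (min_le_right _ _)
      obtain ⟨z, hz, hzj⟩ := ih η' hη'
      have hzD : z ∈ D := by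
        by_contra hzD
        linarith [hM z hzD]
      obtain ⟨y, hy, hyg⟩ := exists_lt_of_lt_gain hN (show gain N c f z - η' < _ by linarith)
      have hloss : loss N c g z ≤ loss N c f z + η' := loss_le hN fun w hw => by
        have := le_loss hc hf hw
        linarith [hleS w]
      have h4 := le_gain hc hg hy
      have h5 := hc z y
      have h6 := hgain z hzD
      have h7 := hfD z hzD
      have h8 := hgD z hzD
      refine ⟨y, by linarith, ?_⟩
      push_cast
      linarith
  obtain ⟨j, hj⟩ := exists_nat_gt (2 * B / (γ / 2))
  rw [div_lt_iff₀ (by linarith)] at hj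
  obtain ⟨z, -, hz⟩ := key j 1 one_pos
  linarith [(abs_le.1 (hf z)).2]

/-- Patching: a discrete subsolution can be lowered slightly to one whose gain is at least `γ`. -/
lemma exists_patch (hN : ∀ x, N x x) (hsymm : ∀ x y, N x y → N y x) (hc : ∀ x y, 0 ≤ c x y)
    {B : ℝ} (hf : ∀ x, |f x| ≤ B) {D : Set X}
    (hfD : ∀ x ∈ D, loss N c f x ≤ gain N c f x) {γ : ℝ} (hγ : 0 < γ)
    {κ : ℝ} (hκ : 0 ≤ κ) (h : X → ℕ) {J : ℕ} (hJ : ∀ x, h x ≤ J)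
    (hh : ∀ x ∈ D, ∃ y, N x y ∧ h y < h x ∧ c x y + c y x ≤ κ) :
    ∃ w : X → ℝ, (∀ x, w x ≤ f x) ∧ (∀ x, f x - J * (κ + 2 * γ) ≤ w x) ∧
      (∀ x ∈ D, γ ≤ gain N c w x) ∧ (∀ x ∈ D, loss N c w x ≤ gain N c w x) := by
  classical
  set W : Set X := {x | x ∈ D ∧ gain N c f x ≤ γ} with hW
  -- Perron's method: `W` is where the gain of `f` is too small, and the patch is the least function
  -- that dominates `f` off `W` and has gain at most `γ` on `W`.
  set F : Set (X → ℝ) := {w | (∀ x ∉ W, f x ≤ w x) ∧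
    ∀ x ∈ W, ∀ y, N x y → w y - c x y - γ ≤ w x} with hF
  -- Follow a path of decreasing `h` until it leaves `W`. A step costs `c x y + γ` by membership in
  -- `F` and `c y x + γ` by `loss ≤ gain ≤ γ` for `f`.
  have hlow : ∀ w ∈ F, ∀ j : ℕ, ∀ x, h x ≤ j → f x - j * (κ + 2 * γ) ≤ w x := by
    rintro w ⟨hw1, hw2⟩ j
    induction j with
    | zero =>
      intro x hx
      have : x ∉ W := fun hxW => by
        obtain ⟨y, -, hy, -⟩ := hh x hxW.1
        omega
      simpa using hw1 x this
    | succ j ih =>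
      intro x hx
      by_cases hxW : x ∈ W
      · obtain ⟨y, hxy, hy, hyκ⟩ := hh x hxW.1
        have h1 := ih y (by omega)
        have h2 := hw2 x hxW y hxy
        have h3 := le_loss hc hf hxy
        have h4 := hfD x hxW.1
        have h5 := hxW.2
        push_cast
        linarith
      · have := hw1 x hxW
        have : 0 ≤ ((j + 1 : ℕ) : ℝ) * (κ + 2 * γ) := by positivity
        linarith
  have hlowJ : ∀ w ∈ F, ∀ x, f x - J * (κ + 2 * γ) ≤ w x := fun w hw x => hlow w hw J x (hJ x)
  have hfF : f ∈ F := by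
    refine ⟨fun x _ => le_rfl, fun x hx y hy => ?_⟩
    have := le_gain hc hf hy
    linarith [hx.2]
  set w : X → ℝ := fun x => ⨅ v : F, v.1 x with hw
  have : Nonempty F := ⟨⟨f, hfF⟩⟩
  have hbdd : ∀ x, BddBelow (range fun v : F => v.1 x) := fun x =>
    ⟨f x - J * (κ + 2 * γ), by rintro _ ⟨v, rfl⟩; exact hlowJ v.1 v.2 x⟩
  have hwle : ∀ v ∈ F, ∀ x, w x ≤ v x := fun v hv x => ciInf_le (hbdd x) ⟨v, hv⟩
  have hwf : ∀ x, w x ≤ f x := hwle f hfF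
  have hwlow : ∀ x, f x - J * (κ + 2 * γ) ≤ w x := fun x => le_ciInf fun v => hlowJ v.1 v.2 x
  have hwF : w ∈ F := by
    refine ⟨fun x hx => le_ciInf fun v => v.2.1 x hx, fun x hx y hy => le_ciInf fun v => ?_⟩
    have h1 := v.2.2 x hx y hy
    have h2 := hwle v.1 v.2 y
    linarith
  have hwB : ∀ x, |w x| ≤ B + J * (κ + 2 * γ) := fun x => by
    have h1 := abs_le.1 (hf x)
    have h2 : 0 ≤ (J : ℝ) * (κ + 2 * γ) := by positivity
    exact abs_le.2 ⟨by linarith [hwlow x], by linarith [hwf x]⟩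
  have hgW : ∀ x ∈ W, γ ≤ gain N c w x := by
    intro x hx
    by_contra! hlt
    -- If the gain were below `γ`, lowering `w` at `x` by the deficit would stay in `F`, against
    -- minimality.
    set θ := γ - gain N c w x with hθ
    have hv : Function.update w x (w x - θ) ∈ F := by
      have hle : ∀ y, Function.update w x (w x - θ) y ≤ w y := fun y => by
        by_cases hyx : y = x
        · subst hyx; simp only [Function.update_self]; linarith
        · simp [Function.update_of_ne hyx]
      refine ⟨fun y hy => ?_, fun y hy z hz => ?_⟩
      · rw [Function.update_of_ne (by rintro rfl; exact hy hx)]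
        exact hwF.1 y hy
      · have h1 := hle z
        by_cases hyx : y = x
        · subst hyx
          have h2 := le_gain hc hwB hz
          simp only [Function.update_self]
          linarith
        · rw [Function.update_of_ne hyx]
          have h2 := hwF.2 y hy z hz
          linarith
    have := hwle _ hv x
    simp only [Function.update_self] at this
    linarith
  have hgnW : ∀ x ∈ D, x ∉ W → γ < gain N c f x ∧ gain N c f x ≤ gain N c w x := by
    intro x hxD hxW
    have hlt : γ < gain N c f x := by
      by_contra! hle
      exact hxW ⟨hxD, hle⟩
    refine ⟨hlt, le_of_forall_lt fun s hs => ?_⟩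
    obtain ⟨y, hy, hys⟩ := exists_lt_of_lt_gain hN (max_lt hs hlt)
    -- The step from `x` gains more than `γ`, so the loss at `y` exceeds `γ`, which is impossible on
    -- `W`.
    have hyW : y ∉ W := fun hyW => by
      have h1 := le_loss hc hf (hsymm x y hy)
      have h2 := hfD y hyW.1
      have h3 := hyW.2
      have := (le_max_right s γ).trans_lt hys
      linarith
    have h1 := hwF.1 y hyW
    have h2 := le_gain hc hwB hy
    have h3 := hwf x
    have := (le_max_left s γ).trans_lt hys
    linarith
  refine ⟨w, hwf, hwlow, fun x hx => ?_, fun x hx => ?_⟩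
  · by_cases hxW : x ∈ W
    · exact hgW x hxW
    · exact (hgnW x hx hxW).1.le.trans (hgnW x hx hxW).2
  · by_cases hxW : x ∈ W
    · refine (loss_le hN fun z hz => ?_).trans (hgW x hxW)
      by_cases hzW : z ∈ W
      · linarith [hwF.2 z hzW x (hsymm x z hz)]
      · have h1 := hwF.1 z hzW
        have h2 := hwf x
        have h3 := le_loss hc hf hz
        linarith [hfD x hx, hxW.2]
    · obtain ⟨h1, h2⟩ := hgnW x hx hxW
      refine (loss_le hN fun z hz => ?_).trans h2
      by_cases hzW : z ∈ W
      · have := hwF.2 z hzW x (hsymm x z hz)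
        linarith
      · have h3 := hwF.1 z hzW
        have h4 := hwf x
        have h5 := le_loss hc hf hz
        linarith [hfD x hx]

/-- Discrete comparison up to the total cost `J * κ` of leaving `D`. -/
lemma discrete_comparison (hN : ∀ x, N x x) (hsymm : ∀ x y, N x y → N y x)
    (hc : ∀ x y, 0 ≤ c x y)
    {B : ℝ} (hf : ∀ x, |f x| ≤ B) (hg : ∀ x, |g x| ≤ B) {D : Set X}
    (hfD : ∀ x ∈ D, loss N c f x ≤ gain N c f x)
    (hgD : ∀ x ∈ D, gain N c g x ≤ loss N c g x)
    {κ : ℝ} (hκ : 0 ≤ κ) (h : X → ℕ) {J : ℕ} (hJ : ∀ x, h x ≤ J)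
    (hh : ∀ x ∈ D, ∃ y, N x y ∧ h y < h x ∧ c x y + c y x ≤ κ)
    {M : ℝ} (hM : ∀ x ∉ D, f x - g x ≤ M) (x : X) : f x - g x ≤ M + J * κ := by
  refine le_of_forall_pos_le_add fun ε hε => ?_
  obtain ⟨γ, hγ, hγε⟩ : ∃ γ > 0, J * (2 * γ) ≤ ε := by
    refine ⟨ε / (2 * (J + 1)), by positivity, ?_⟩
    rw [show (J : ℝ) * (2 * (ε / (2 * (J + 1)))) = ε * (J / (J + 1)) by field_simp]
    exact mul_le_of_le_one_right hε.le ((div_le_one (by positivity)).2 (by linarith))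
  obtain ⟨w, hwf, hwlow, hwγ, hwD⟩ := exists_patch hN hsymm hc hf hfD hγ hκ h hJ hh
  have hwB : ∀ x, |w x| ≤ B + J * (κ + 2 * γ) := fun x => by
    have h1 := abs_le.1 (hf x)
    have h2 : 0 ≤ (J : ℝ) * (κ + 2 * γ) := by positivity
    exact abs_le.2 ⟨by linarith [hwlow x], by linarith [hwf x]⟩
  have hgB : ∀ x, |g x| ≤ B + J * (κ + 2 * γ) := fun x => by
    have h2 : 0 ≤ (J : ℝ) * (κ + 2 * γ) := by positivity
    linarith [hg x]
  have := discrete_comparison_of_gain_ge hN hc hwB hgB hwD hgD hγ hwγ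
    (fun x hx => (by linarith [hM x hx, hwf x] : w x - g x ≤ M)) x
  linarith [hwlow x]

end Discrete

/-! ### Sublevel sets of `H` and their support functions -/

section Cones

variable {E : Type*} [NormedAddCommGroup E] [InnerProductSpace ℝ E]

/-- The sublevel set `{H ≤ s}`. -/
def lev (H : E → ℝ) (s : ℝ) : Set E := {p | H p ≤ s}

/-- The support function of the sublevel set `{H ≤ s}`. -/
def cone (H : E → ℝ) (s : ℝ) (y : E) : ℝ := sSup ((fun p => inner ℝ p y) '' lev H s)

variable {H : E → ℝ}

/-- On a sphere enclosing the bounded zero set, `H ≥ c > 0`. Convexity and `H 0 = 0` turn this into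
linear growth outside it. -/
lemma ConvexOn.isCompact_lev [FiniteDimensional ℝ E] (hconv : ConvexOn ℝ univ H)
    (hzero : H 0 = 0) (hmin : ∀ p, 0 ≤ H p) (hbdd : Bornology.IsBounded {p | H p = 0}) (s : ℝ) :
    IsCompact (lev H s) := by
  have hcont : Continuous H := continuousOn_univ.1 (hconv.continuousOn isOpen_univ)
  refine Metric.isCompact_of_isClosed_isBounded (isClosed_le hcont continuous_const) ?_
  obtain ⟨R, hR0, hR⟩ : ∃ R > 0, ∀ p, H p = 0 → ‖p‖ < R := by
    obtain ⟨R, hR⟩ := hbdd.exists_norm_le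
    exact ⟨max R 0 + 1, by positivity, fun p hp =>
      ((hR p hp).trans (le_max_left _ _)).trans_lt (lt_add_one _)⟩
  obtain ⟨c, hc0, hc⟩ : ∃ c > 0, ∀ p ∈ Metric.sphere (0 : E) R, c ≤ H p := by
    rcases (Metric.sphere (0 : E) R).eq_empty_or_nonempty with h | h
    · exact ⟨1, one_pos, by simp [h]⟩
    · obtain ⟨p, hp, hpm⟩ := (isCompact_sphere (0 : E) R).exists_isMinOn h hcont.continuousOn
      refine ⟨H p, lt_of_le_of_ne (hmin p) fun h0 => ?_, fun q hq => hpm hq⟩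
      have := hR p h0.symm
      simp_all
  refine isBounded_iff_forall_norm_le.2 ⟨max R (R * s / c), fun p hp => ?_⟩
  rcases le_total ‖p‖ R with h | h
  · exact h.trans (le_max_left _ _)
  · refine le_trans ?_ (le_max_right _ _)
    have hp0 : 0 < ‖p‖ := hR0.trans_le h
    have h1 := hc ((R / ‖p‖) • p) (by
      rw [mem_sphere_zero_iff_norm, norm_smul, Real.norm_of_nonneg (by positivity)]
      field_simp)
    have h2 := hconv.2 (mem_univ p) (mem_univ 0) (show 0 ≤ R / ‖p‖ by positivity)
      (show 0 ≤ 1 - R / ‖p‖ by rw [sub_nonneg, div_le_one hp0]; exact h) (by ring)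
    simp only [smul_zero, add_zero, hzero, smul_eq_mul, mul_zero] at h2
    have h3 : c ≤ R / ‖p‖ * s := (h1.trans h2).trans
      (mul_le_mul_of_nonneg_left hp (by positivity))
    rw [le_div_iff₀ hc0]
    calc ‖p‖ * c ≤ ‖p‖ * (R / ‖p‖ * s) := by gcongr
      _ = R * s := by field_simp

lemma inner_le_cone (hK : ∀ s, IsCompact (lev H s)) {s : ℝ} {p : E} (hp : H p ≤ s) (y : E) :
    inner ℝ p y ≤ cone H s y :=
  le_csSup ((hK s).image (by fun_prop)).bddAbove ⟨p, hp, rfl⟩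

lemma exists_cone_eq (hK : ∀ s, IsCompact (lev H s)) (hzero : H 0 = 0) {s : ℝ} (hs : 0 ≤ s)
    (y : E) : ∃ p, H p ≤ s ∧ cone H s y = inner ℝ p y := by
  have hne : (lev H s).Nonempty := ⟨0, by simpa [lev, hzero] using hs⟩
  obtain ⟨p, hp, h⟩ := ((hK s).image (f := fun p => inner ℝ p y) (by fun_prop)).sSup_mem
    (hne.image _)
  exact ⟨p, hp, h.symm⟩

lemma cone_zero (hK : ∀ s, IsCompact (lev H s)) (hzero : H 0 = 0) {s : ℝ} (hs : 0 ≤ s) :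
    cone H s 0 = 0 := by
  obtain ⟨p, -, hp⟩ := exists_cone_eq hK hzero hs 0
  simpa using hp

lemma cone_smul (hK : ∀ s, IsCompact (lev H s)) (hzero : H 0 = 0) {s : ℝ} (hs : 0 ≤ s)
    {a : ℝ} (ha : 0 ≤ a) (y : E) : cone H s (a • y) = a * cone H s y := by
  apply le_antisymm
  · obtain ⟨p, hp, h⟩ := exists_cone_eq hK hzero hs (a • y)
    rw [h, inner_smul_right]
    exact mul_le_mul_of_nonneg_left (inner_le_cone hK hp y) ha
  · obtain ⟨p, hp, h⟩ := exists_cone_eq hK hzero hs y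
    rw [h, ← inner_smul_right]
    exact inner_le_cone hK hp _

lemma exists_lipschitzWith_cone (hK : ∀ s, IsCompact (lev H s)) (hzero : H 0 = 0) {s : ℝ}
    (hs : 0 ≤ s) : ∃ K : NNReal, LipschitzWith K (cone H s) := by
  obtain ⟨R, hR⟩ := (hK s).isBounded.exists_norm_le
  refine ⟨R.toNNReal, LipschitzWith.of_le_add_mul _ fun x y => ?_⟩
  obtain ⟨p, hp, h⟩ := exists_cone_eq hK hzero hs x
  have h1 := inner_le_cone hK hp y
  have h2 : inner ℝ p (x - y) ≤ R * dist x y := by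
    rw [dist_eq_norm]
    exact (real_inner_le_norm _ _).trans (by gcongr; exact hR p hp)
  rw [inner_sub_right] at h2
  rw [h, Real.coe_toNNReal R ((norm_nonneg p).trans (hR p hp))]
  linarith

lemma continuous_cone (hK : ∀ s, IsCompact (lev H s)) (hzero : H 0 = 0) {s : ℝ}
    (hs : 0 ≤ s) : Continuous (cone H s) :=
  let ⟨_, h⟩ := exists_lipschitzWith_cone hK hzero hs
  h.continuous

/-- Maximizers at levels `s` and `r` combine, by convexity of `H`, to an admissible point at the
intermediate level. -/
lemma cone_concave (hK : ∀ s, IsCompact (lev H s)) (hzero : H 0 = 0) (hconv : ConvexOn ℝ univ H)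
    {s r a b : ℝ} (hs : 0 ≤ s) (hr : 0 ≤ r) (ha : 0 ≤ a) (hb : 0 ≤ b) (hab : a + b = 1) (y : E) :
    a * cone H s y + b * cone H r y ≤ cone H (a * s + b * r) y := by
  obtain ⟨p, hp, h⟩ := exists_cone_eq hK hzero hs y
  obtain ⟨q, hq, h'⟩ := exists_cone_eq hK hzero hr y
  rw [h, h', ← real_inner_smul_left, ← real_inner_smul_left, ← inner_add_left]
  refine inner_le_cone hK ((hconv.2 (mem_univ p) (mem_univ q) ha hb hab).trans ?_) y
  simp only [smul_eq_mul]
  gcongr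

/-- A maximizing `p` gives an affine function touching the cone from below, so the gradient, if it
exists, is `p`. Elsewhere `gradient` is `0` by convention, and `H 0 = 0 ≤ s`. -/
lemma H_gradient_cone_le [CompleteSpace E] (hK : ∀ s, IsCompact (lev H s)) (hzero : H 0 = 0)
    {s : ℝ} (hs : 0 ≤ s) (z : E) (c : ℝ) (x : E) :
    H (gradient (fun x => cone H s (x - z) + c) x) ≤ s := by
  by_cases hd : DifferentiableAt ℝ (fun x => cone H s (x - z) + c) x
  · obtain ⟨p, hp, h⟩ := exists_cone_eq hK hzero hs (x - z)
    have hmin : IsLocalMin (fun y => cone H s (y - z) + c - inner ℝ p y) x :=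
      Eventually.of_forall fun y => by
        have := inner_le_cone hK hp (y - z)
        rw [inner_sub_right] at this h
        simp only [h]
        linarith [inner_sub_right (𝕜 := ℝ) p x z]
    have hg := (hd.hasGradientAt.hasFDerivAt.sub (innerSL ℝ p).hasFDerivAt)
    have h0 := hmin.hasFDerivAt_eq_zero hg
    have : gradient (fun x => cone H s (x - z) + c) x = p := by
      refine ext_inner_right ℝ fun v => ?_
      have := congrArg (fun L : E →L[ℝ] ℝ => L v) h0
      simpa [sub_eq_zero] using this
    rwa [this]
  · rw [gradient_eq_zero_of_not_differentiableAt hd, hzero]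
    exact hs

end Cones

/-! ### Integrating an almost everywhere gradient bound along segments -/

section Segments

variable {n : ℕ}

lemma ae_ae_translate {P : EuclideanSpace ℝ (Fin n) → Prop} (hP : ∀ᵐ x, P x)
    (w : EuclideanSpace ℝ (Fin n)) :
    ∀ᵐ h : EuclideanSpace ℝ (Fin n), ∀ᵐ s : ℝ, P (h + s • w) := by
  set T := toMeasurable volume {x | ¬ P x}
  have hT : volume T = 0 := by rw [measure_toMeasurable]; exact hP
  have hTm : MeasurableSet T := measurableSet_toMeasurable _ _
  set A : Set (ℝ × EuclideanSpace ℝ (Fin n)) := (fun q => q.2 + q.1 • w) ⁻¹' T with hA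
  have hAm : MeasurableSet A := hTm.preimage (by fun_prop)
  have hA0 : (volume : Measure ℝ).prod (volume : Measure (EuclideanSpace ℝ (Fin n))) A = 0 := by
    rw [Measure.measure_prod_null hAm]
    refine Eventually.of_forall fun s => ?_
    change volume ((fun h => h + s • w) ⁻¹' T) = 0
    rw [measure_preimage_add_right, hT]
  have hA1 : (volume : Measure (EuclideanSpace ℝ (Fin n))).prod (volume : Measure ℝ)
      (Prod.swap ⁻¹' A) = 0 := by
    rw [← Measure.map_apply measurable_swap hAm, Measure.prod_swap, hA0]
  have := Measure.ae_ae_of_ae_prod (p := fun q => q ∉ Prod.swap ⁻¹' A)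
    (measure_eq_zero_iff_ae_notMem.1 hA1)
  filter_upwards [this] with h hh
  filter_upwards [hh] with s hs
  by_contra hcon
  exact hs (subset_toMeasurable _ _ hcon)

/-- The given segment may lie in the exceptional null set. By Fubini almost every parallel translate
meets that set in a null set of parameters; the bound is integrated there and passed to the limit.
-/
lemma sub_le_of_ae_gradient {W : Set (EuclideanSpace ℝ (Fin n))} (hW : IsOpen W)
    {u : EuclideanSpace ℝ (Fin n) → ℝ} {K : NNReal} (hu : LipschitzOnWith K u W)
    {w : EuclideanSpace ℝ (Fin n)} {C : ℝ}
    (hC : ∀ᵐ x, x ∈ W → inner ℝ (gradient u x) w ≤ C)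
    {y : EuclideanSpace ℝ (Fin n)} (hseg : ∀ s ∈ Icc (0 : ℝ) 1, y + s • w ∈ W) :
    u (y + w) - u y ≤ C := by
  have hdiff : ∀ᵐ x, x ∈ W → DifferentiableAt ℝ u x := by
    filter_upwards [hu.ae_differentiableWithinAt_of_mem (μ := volume)] with x hx hxW
    exact (hx hxW).differentiableAt (hW.mem_nhds hxW)
  have hgood : ∀ᵐ h : EuclideanSpace ℝ (Fin n), ∀ᵐ s : ℝ, h + s • w ∈ W →
      DifferentiableAt ℝ u (h + s • w) ∧ inner ℝ (gradient u (h + s • w)) w ≤ C := by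
    refine ae_ae_translate (P := fun x => x ∈ W →
      DifferentiableAt ℝ u x ∧ inner ℝ (gradient u x) w ≤ C) ?_ w
    filter_upwards [hdiff, hC] with x h1 h2 hx using ⟨h1 hx, h2 hx⟩
  have hcpt : IsCompact ((fun s : ℝ => y + s • w) '' Icc 0 1) :=
    isCompact_Icc.image (by fun_prop)
  obtain ⟨δ, hδ, hsub⟩ := hcpt.exists_thickening_subset_open hW
    (by rintro _ ⟨s, hs, rfl⟩; exact hseg s hs)
  have hnear : ∀ h ∈ Metric.ball y δ, ∀ s ∈ Icc (0 : ℝ) 1, h + s • w ∈ W := fun h hh s hs =>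
    hsub (Metric.mem_thickening_iff.2 ⟨y + s • w, ⟨s, hs, rfl⟩, by simpa using hh⟩)
  have hfreq : ∃ᶠ h in 𝓝 y, u (h + w) - u h ≤ C := by
    have hd := (Measure.dense_of_ae hgood y)
    rw [mem_closure_iff_frequently] at hd
    refine (hd.and_eventually (Metric.ball_mem_nhds y hδ)).mono fun h ⟨hh, hb⟩ => ?_
    have hline : LipschitzOnWith (K * ‖w‖₊) (fun s : ℝ => u (h + s • w)) (uIcc 0 1) := by
      rw [uIcc_of_le zero_le_one]
      have hg : LipschitzOnWith ‖w‖₊ (fun s : ℝ => h + s • w) (Icc 0 1) := by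
        refine (LipschitzWith.of_dist_le_mul fun s r => ?_).lipschitzOnWith
        rw [dist_add_left, dist_eq_norm, ← sub_smul, norm_smul, mul_comm, ← dist_eq_norm,
          coe_nnnorm]
      exact hu.comp hg fun s hs => hnear h hb s hs
    have hac := hline.absolutelyContinuousOnInterval
    have hint := hac.integral_deriv_eq_sub
    have hmono : ∫ s in (0 : ℝ)..1, deriv (fun s : ℝ => u (h + s • w)) s ≤
        ∫ s in (0 : ℝ)..1, C := by
      refine intervalIntegral.integral_mono_ae_restrict zero_le_one hac.intervalIntegrable_deriv
        intervalIntegrable_const ?_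
      rw [EventuallyLE, ae_restrict_iff' measurableSet_Icc]
      filter_upwards [hh] with s hs hs01
      obtain ⟨h1, h2⟩ := hs (hnear h hb s hs01)
      have hl : HasDerivAt (fun s : ℝ => h + s • w) w s := by
        simpa using ((hasDerivAt_id s).smul_const w).const_add h
      have hd : HasDerivAt (fun s : ℝ => u (h + s • w)) (fderiv ℝ u (h + s • w) w) s :=
        h1.hasFDerivAt.comp_hasDerivAt s hl
      rw [hd.deriv, ← inner_gradient_left]
      exact h2
    simp only [one_smul, zero_smul, add_zero] at hint
    rw [← hint]
    simpa using hmono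
  refine le_of_tendsto_of_frequently (f := fun h => u (h + w) - u h) (x := 𝓝 y) ?_ hfreq
  have c1 : ContinuousAt u (y + w) := hu.continuousOn.continuousAt
    (hW.mem_nhds (by simpa using hseg 1 (by simp)))
  have c2 : ContinuousAt u y := hu.continuousOn.continuousAt
    (hW.mem_nhds (by simpa using hseg 0 (by simp)))
  have c3 : ContinuousAt (fun h => u (h + w)) y :=
    ContinuousAt.comp (g := u) (f := fun h => h + w) c1 (by fun_prop)
  exact c3.sub c2

end Segments

/-! ### Subminimizers compare with cones -/

section ComparisonWithCones

variable {n : ℕ} {H : EuclideanSpace ℝ (Fin n) → ℝ} {U : Set (EuclideanSpace ℝ (Fin n))}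
  {u v : EuclideanSpace ℝ (Fin n) → ℝ}

/-- `u` enjoys comparison with cones from above in `U`. -/
def ComparisonWithCones (H : EuclideanSpace ℝ (Fin n) → ℝ) (U : Set (EuclideanSpace ℝ (Fin n)))
    (u : EuclideanSpace ℝ (Fin n) → ℝ) : Prop :=
  ∀ V, CompactlyInside V U → ∀ s ≥ 0, ∀ z c,
    (∀ y ∈ frontier V, u y ≤ cone H s (y - z) + c) → (z ∈ V → u z ≤ c) →
    ∀ y ∈ V, u y ≤ cone H s (y - z) + c

lemma LipLoc.continuousOn (hU : IsOpen U) (hu : LipLoc U u) : ContinuousOn u U := by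
  intro x hx
  obtain ⟨r, hr, hsub⟩ := Metric.nhds_basis_closedBall.mem_iff.1 (hU.mem_nhds hx)
  obtain ⟨K, hK⟩ := hu (Metric.ball x r) ⟨Metric.isOpen_ball,
    (isCompact_closedBall x r).of_isClosed_subset isClosed_closure Metric.closure_ball_subset_closedBall,
    Metric.closure_ball_subset_closedBall.trans hsub⟩
  exact (hK.continuousOn.continuousAt (Metric.ball_mem_nhds x hr)).continuousWithinAt

lemma AbsSubminimizing.comparisonWithCones (hU : IsOpen U) (hK : ∀ s, IsCompact (lev H s))
    (hzero : H 0 = 0) (hu : AbsSubminimizing H U u) : ComparisonWithCones H U u := by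
  rintro V ⟨hVo, hVc, hVU⟩ s hs z c hfr hz x hx
  by_contra! hlt
  have hcu := hu.1.continuousOn hU
  set w : EuclideanSpace ℝ (Fin n) → ℝ := fun y => cone H s (y - z) + c with hw
  have hcw : Continuous w := ((continuous_cone hK hzero hs).comp (by fun_prop)).add_const c
  set W : Set (EuclideanSpace ℝ (Fin n)) := {y | y ∈ V ∧ w y < u y} with hW
  have hxW : x ∈ W := ⟨hx, hlt⟩
  have hWV : W ⊆ V := fun y hy => hy.1
  have hclWU : closure W ⊆ U := (closure_mono hWV).trans hVU
  have hWo : IsOpen W := by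
    refine isOpen_iff_mem_nhds.2 fun y hy => ?_
    have h1 : ContinuousAt u y := hcu.continuousAt (hU.mem_nhds (hVU (subset_closure hy.1)))
    filter_upwards [hVo.mem_nhds hy.1, hcw.continuousAt.eventually_lt h1 hy.2] with q h2 h3
      using ⟨h2, h3⟩
  have hWc : CompactlyInside W U :=
    ⟨hWo, hVc.of_isClosed_subset isClosed_closure (closure_mono hWV), hclWU⟩
  have hge : ∀ y ∈ closure W, w y ≤ u y := fun y hy => by
    rw [mem_closure_iff_frequently] at hy
    by_contra! hlt'
    have h1 : ContinuousAt u y := hcu.continuousAt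
      (hU.mem_nhds (hclWU (mem_closure_iff_frequently.2 hy)))
    obtain ⟨q, hq1, hq2⟩ := (hy.and_eventually (h1.eventually_lt hcw.continuousAt hlt')).exists
    exact lt_asymm hq1.2 hq2
  have hle : ∀ y ∈ closure W, y ∉ W → u y ≤ w y := fun y hy hyW => by
    by_cases hyV : y ∈ V
    · by_contra! hlt'
      exact hyW ⟨hyV, hlt'⟩
    · exact hfr y ⟨closure_mono hWV hy, by rwa [hVo.interior_eq]⟩
  have hcomp : Competitor W u w := by
    refine ⟨fun V' _ => ?_, hcw.continuousOn, fun y hy => ?_⟩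
    · obtain ⟨K, hK⟩ := exists_lipschitzWith_cone hK hzero hs
      refine ⟨K, LipschitzWith.lipschitzOnWith (LipschitzWith.of_dist_le_mul fun a b => ?_)⟩
      have := hK.dist_le_mul (a - z) (b - z)
      simpa [hw] using this
    · rw [hWo.frontier_eq] at hy
      exact le_antisymm (hge y hy.1) (hle y hy.1 hy.2)
  have hsup : supH H W u ≤ (s : EReal) :=
    (hu.2 W hWc w hcomp fun y hy => hy.2.le).trans
      (essSup_le_of_ae_le _ (Eventually.of_forall fun y =>
        EReal.coe_le_coe_iff.2 (H_gradient_cone_le hK hzero hs z c y)))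
  have hgrad : ∀ᵐ y, y ∈ W → H (gradient u y) ≤ s := by
    rw [← ae_restrict_iff' hWo.measurableSet]
    filter_upwards [ae_le_essSup (μ := volume.restrict W)
      (f := fun x => ((H (gradient u x) : ℝ) : EReal))] with y hy
    exact EReal.coe_le_coe_iff.1 (hy.trans hsup)
  obtain ⟨K, hKu⟩ := hu.1 W hWc
  have hzW : z ∉ W := fun hzW => by
    have h1 := hz hzW.1
    have h2 := hzW.2
    simp only [hw, sub_self, cone_zero hK hzero hs] at h2
    linarith
  set ray : ℝ → EuclideanSpace ℝ (Fin n) := fun r => z + r • (x - z) with hray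
  have hrayc : Continuous ray := by fun_prop
  have hScpt : IsCompact (Icc (0 : ℝ) 1 ∩ ray ⁻¹' Wᶜ) :=
    isCompact_Icc.inter_right (hWo.isClosed_compl.preimage hrayc)
  -- The last point outside `W` on the way from the vertex `z` to `x`: there `u ≤ w`, and beyond it
  -- the gradient bound applies.
  obtain ⟨r₀, ⟨hr01, hr0W⟩, hr0max⟩ := hScpt.exists_isMaxOn
    ⟨0, ⟨by simp, by simpa [hray] using hzW⟩⟩ continuous_id.continuousOn
  have hr0lt : r₀ < 1 := lt_of_le_of_ne hr01.2 fun h => hr0W (by simpa [h, hray] using hxW)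
  have hin : ∀ r, r₀ < r → r ≤ 1 → ray r ∈ W := fun r h1 h2 => by
    by_contra hcon
    exact absurd (hr0max ⟨⟨hr01.1.trans h1.le, h2⟩, hcon⟩) (not_le.2 h1)
  have hcl : ray r₀ ∈ closure W := by
    refine mem_closure_of_tendsto (hrayc.continuousAt.tendsto.mono_left
      (nhdsWithin_le_nhds (s := Ioi r₀))) ?_
    filter_upwards [Ioo_mem_nhdsGT hr0lt] with r hr using hin r hr.1 hr.2.le
  have hbound : ∀ r, r₀ < r → r ≤ 1 → u x - u (ray r) ≤ (1 - r) * cone H s (x - z) := by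
    intro r h1 h2
    have := sub_le_of_ae_gradient hWo hKu (w := (1 - r) • (x - z)) (y := ray r)
      (C := cone H s ((1 - r) • (x - z))) (by
        filter_upwards [hgrad] with y hy hyW using inner_le_cone hK (hy hyW) _)
      (fun a ha => by
        have : ray r + a • (1 - r) • (x - z) = ray (r + a * (1 - r)) := by
          simp only [hray]; module
        rw [this]
        exact hin _ (by nlinarith [ha.1]) (by nlinarith [ha.2]))
    rw [cone_smul hK hzero hs (by linarith)] at this
    convert this using 3
    simp only [hray]; module
  have hlim : u x - u (ray r₀) ≤ (1 - r₀) * cone H s (x - z) := by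
    have h1 : ContinuousAt u (ray r₀) := hcu.continuousAt (hU.mem_nhds (hclWU hcl))
    have h2 : ContinuousAt (fun r => u (ray r)) r₀ :=
      ContinuousAt.comp (g := u) (f := ray) h1 hrayc.continuousAt
    have h3 : ContinuousAt (fun r : ℝ => (1 - r) * cone H s (x - z)) r₀ := by fun_prop
    refine le_of_tendsto_of_tendsto ((continuousAt_const.sub h2).tendsto.mono_left
      (nhdsWithin_le_nhds (s := Ioi r₀))) (h3.tendsto.mono_left nhdsWithin_le_nhds) ?_
    filter_upwards [Ioo_mem_nhdsGT hr0lt] with r hr using hbound r hr.1 hr.2.le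
  have h1 := hle _ hcl hr0W
  have h2 : w (ray r₀) = r₀ * cone H s (x - z) + c := by
    simp only [hw, hray, add_sub_cancel_left]
    rw [cone_smul hK hzero hs hr01.1]
  have h3 : w x = cone H s (x - z) + c := rfl
  linarith [hxW.2]

lemma gradient_neg (x : EuclideanSpace ℝ (Fin n)) :
    gradient (fun y => -u y) x = -gradient u x := by
  simp [gradient, fderiv_fun_neg]

lemma supH_neg (V : Set (EuclideanSpace ℝ (Fin n))) :
    supH (fun p => H (-p)) V (fun y => -u y) = supH H V u := by
  simp [supH, gradient_neg]

lemma LipLoc.neg (hu : LipLoc U u) : LipLoc U (fun y => -u y) := fun V hV =>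
  let ⟨K, hK⟩ := hu V hV
  ⟨K, hK.neg⟩

lemma AbsSuperminimizing.neg (hu : AbsSuperminimizing H U u) :
    AbsSubminimizing (fun p => H (-p)) U (fun y => -u y) := by
  refine ⟨hu.1.neg, fun V hV w hw hwu => ?_⟩
  have hw' : Competitor V u (fun y => -w y) :=
    ⟨hw.1.neg, hw.2.1.neg, fun y hy => by simp [hw.2.2 hy]⟩
  have := hu.2 V hV _ hw' fun x hx => by linarith [hwu x hx]
  rw [← supH_neg (u := fun y => -w y)] at this
  simpa [supH_neg] using this

lemma AbsMinimizing.absSubminimizing (hu : AbsMinimizing H U u) : AbsSubminimizing H U u :=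
  ⟨hu.1, fun V hV v hv _ => hu.2 V hV v hv⟩

lemma AbsMinimizing.absSuperminimizing (hu : AbsMinimizing H U u) : AbsSuperminimizing H U u :=
  ⟨hu.1, fun V hV v hv _ => hu.2 V hV v hv⟩

end ComparisonWithCones

/-! ### The truncated Legendre cost -/

section Cost

variable {E : Type*} [NormedAddCommGroup E] [InnerProductSpace ℝ E] {H : E → ℝ}

/-- The cost of the displacement `w` in time `t`: `t L(w / t)`, where `L` is the Legendre
transform of `H` restricted to the sublevel set `{H ≤ S}`. -/
def cost (H : E → ℝ) (S t : ℝ) (w : E) : ℝ := sSup ((fun p => inner ℝ p w - t * H p) '' lev H S)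

lemma le_cost (hcont : Continuous H) (hK : ∀ s, IsCompact (lev H s)) {S : ℝ} {p : E}
    (hp : H p ≤ S) (t : ℝ) (w : E) : inner ℝ p w - t * H p ≤ cost H S t w :=
  le_csSup ((hK S).image (by fun_prop)).bddAbove ⟨p, hp, rfl⟩

lemma exists_cost_eq (hcont : Continuous H) (hK : ∀ s, IsCompact (lev H s)) (hzero : H 0 = 0)
    {S : ℝ} (hS : 0 ≤ S) (t : ℝ) (w : E) :
    ∃ p, H p ≤ S ∧ cost H S t w = inner ℝ p w - t * H p := by
  have hne : (lev H S).Nonempty := ⟨0, by simpa [lev, hzero] using hS⟩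
  obtain ⟨p, hp, h⟩ := ((hK S).image (f := fun p => inner ℝ p w - t * H p) (by fun_prop)).sSup_mem
    (hne.image _)
  exact ⟨p, hp, h.symm⟩

lemma cost_nonneg (hcont : Continuous H) (hK : ∀ s, IsCompact (lev H s)) (hzero : H 0 = 0)
    {S : ℝ} (hS : 0 ≤ S) (t : ℝ) (w : E) : 0 ≤ cost H S t w := by
  simpa [hzero] using le_cost hcont hK (hzero.le.trans hS) t w

lemma cost_zero (hcont : Continuous H) (hK : ∀ s, IsCompact (lev H s)) (hzero : H 0 = 0)
    (hmin : ∀ p, 0 ≤ H p) {S t : ℝ} (hS : 0 ≤ S) (ht : 0 ≤ t) : cost H S t 0 = 0 := by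
  refine le_antisymm ?_ (cost_nonneg hcont hK hzero hS t 0)
  obtain ⟨p, -, hp⟩ := exists_cost_eq hcont hK hzero hS t (0 : E)
  rw [hp, inner_zero_right]
  linarith [mul_nonneg ht (hmin p)]

lemma two_mul_cost_le (hcont : Continuous H) (hK : ∀ s, IsCompact (lev H s)) (hzero : H 0 = 0)
    {S : ℝ} (hS : 0 ≤ S) (t : ℝ) (w : E) :
    2 * cost H S t w ≤ cost H S (2 * t) ((2 : ℝ) • w) := by
  obtain ⟨p, hp, h⟩ := exists_cost_eq hcont hK hzero hS t w
  have := le_cost hcont hK hp (2 * t) ((2 : ℝ) • w)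
  rw [inner_smul_right] at this
  rw [h]
  linarith

lemma cost_comp_neg (S t : ℝ) (w : E) : cost (fun p => H (-p)) S t w = cost H S t (-w) := by
  unfold cost
  congr 1
  ext r
  constructor
  · rintro ⟨p, hp, rfl⟩
    exact ⟨-p, hp, by simp⟩
  · rintro ⟨p, hp, rfl⟩
    exact ⟨-p, by simpa [lev] using hp, by simp⟩

/-- Grouping `p` by the level `s = H p` shows, together with `exists_cost_le`, that the cost is the
maximum of `cone H s w - t * s` over `0 ≤ s ≤ S`. -/
lemma cone_sub_le_cost (hcont : Continuous H) (hK : ∀ s, IsCompact (lev H s)) (hzero : H 0 = 0)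
    {S s t : ℝ} (hs : 0 ≤ s) (hsS : s ≤ S) (ht : 0 ≤ t) (w : E) :
    cone H s w - t * s ≤ cost H S t w := by
  obtain ⟨p, hp, h⟩ := exists_cone_eq hK hzero hs w
  have := le_cost hcont hK (hp.trans hsS) t w
  linarith [mul_le_mul_of_nonneg_left hp ht]

lemma exists_cost_le (hcont : Continuous H) (hK : ∀ s, IsCompact (lev H s)) (hzero : H 0 = 0)
    (hmin : ∀ p, 0 ≤ H p) {S : ℝ} (hS : 0 ≤ S) (t : ℝ) (w : E) :
    ∃ s, 0 ≤ s ∧ s ≤ S ∧ cost H S t w ≤ cone H s w - t * s := by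
  obtain ⟨p, hp, h⟩ := exists_cost_eq hcont hK hzero hS t w
  exact ⟨H p, hmin p, hp, by linarith [inner_le_cone hK le_rfl w (p := p)]⟩

/-- Test with the vector of length `K` in the direction of `w`. For a `K`-Lipschitz function this
bounds every increment by the cost plus `t * k`. -/
lemma mul_norm_le_cost (hcont : Continuous H) (hK : ∀ s, IsCompact (lev H s))
    {K k S t : ℝ} (hK0 : 0 ≤ K) (hk : ∀ p, ‖p‖ ≤ K → H p ≤ k) (hkS : k ≤ S) (ht : 0 ≤ t) (w : E) :
    K * ‖w‖ ≤ cost H S t w + t * k := by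
  have hp : H ((K * ‖w‖⁻¹) • w) ≤ k := hk _ (by
    rw [norm_smul, Real.norm_of_nonneg (by positivity), mul_assoc]
    exact mul_le_of_le_one_right hK0 (inv_mul_le_one))
  have h1 := le_cost hcont hK (hp.trans hkS) t w
  have h2 : inner ℝ ((K * ‖w‖⁻¹) • w) w = K * ‖w‖ := by
    rw [real_inner_smul_left, real_inner_self_eq_norm_sq]
    by_cases hw : ‖w‖ = 0
    · simp [hw]
    · field_simp
  linarith [mul_le_mul_of_nonneg_left hp ht]

end Cost

/-! ### Sup-convolution over balls -/

section SupConvolution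

variable {E : Type*} [NormedAddCommGroup E]

/-- The supremum over the ball of radius `ρ` of `u` minus the cost `c` of moving there. -/
def supConv (c : E → ℝ) (ρ : ℝ) (u : E → ℝ) (x : E) : ℝ :=
  ⨆ y : Metric.closedBall x ρ, (u y - c (y - x))

lemma le_supConv {c : E → ℝ} (hc : ∀ w, 0 ≤ c w) {ρ B : ℝ} {u : E → ℝ} {x y : E}
    (hu : ∀ y ∈ Metric.closedBall x ρ, u y ≤ B) (hy : y ∈ Metric.closedBall x ρ) :
    u y - c (y - x) ≤ supConv c ρ u x := by
  refine le_ciSup (f := fun y : Metric.closedBall x ρ => u y - c (y - x)) ⟨B, ?_⟩ ⟨y, hy⟩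
  rintro _ ⟨z, rfl⟩
  have h1 := hu z z.2
  have h2 := hc (z - x)
  simp only
  linarith

lemma supConv_le {c : E → ℝ} {ρ s : ℝ} (hρ : 0 ≤ ρ) {u : E → ℝ} {x : E}
    (h : ∀ y ∈ Metric.closedBall x ρ, u y - c (y - x) ≤ s) : supConv c ρ u x ≤ s :=
  have : Nonempty (Metric.closedBall x ρ) := ⟨⟨x, Metric.mem_closedBall_self hρ⟩⟩
  ciSup_le fun y => h y y.2

end SupConvolution

/-! ### From cone comparison to the discrete inequality -/

section ConvexityCriterion

variable {n : ℕ} {H : EuclideanSpace ℝ (Fin n) → ℝ} {U : Set (EuclideanSpace ℝ (Fin n))}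
  {u : EuclideanSpace ℝ (Fin n) → ℝ}

/-- Write `A = 2 * t * k`, and the cost at time `2t` as a maximum over levels. Where levels at least
`k` suffice, half of the time penalty absorbs `A / 2`. Where some level below `k` does better than
`k`, comparison with the single cone of level `k` gives the bound. -/
lemma ComparisonWithCones.le_add_cost (hu : ComparisonWithCones H U u)
    (hconv : ConvexOn ℝ univ H) (hcont : Continuous H) (hK : ∀ s, IsCompact (lev H s))
    (hzero : H 0 = 0) (hmin : ∀ p, 0 ≤ H p) {x : EuclideanSpace ℝ (Fin n)} {R : ℝ}
    (hRU : Metric.closedBall x R ⊆ U) {k₀ S t : ℝ} (ht : 0 < t) (hSR : 2 * t * S ≤ R)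
    (hk₀S : k₀ ≤ S) (hS : ∀ p q, H p ≤ k₀ → ‖q‖ ≤ 1 → H (p + q) ≤ S)
    {A : ℝ} (hA0 : 0 ≤ A) (hAk : A ≤ 2 * t * k₀)
    (hA : ∀ y ∈ Metric.closedBall x R, u y ≤ u x + A + cost H S (2 * t) (y - x)) :
    ∀ y ∈ Metric.closedBall x R, u y ≤ u x + A / 2 + cost H S t (y - x) := by
  obtain ⟨k, rfl⟩ : ∃ k, A = 2 * t * k := ⟨A / (2 * t), by field_simp⟩
  have hk0 : 0 ≤ k := nonneg_of_mul_nonneg_right hA0 (by linarith)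
  have hkk₀ : k ≤ k₀ := le_of_mul_le_mul_left hAk (by linarith)
  have hkS : k ≤ S := hkk₀.trans hk₀S
  have hS0 : 0 ≤ S := hk0.trans hkS
  set I : Set (EuclideanSpace ℝ (Fin n)) :=
    {y | ∃ s, 0 ≤ s ∧ s < k ∧ cone H k (y - x) - 2 * t * k < cone H s (y - x) - 2 * t * s} with hI
  have hcc : ∀ s, 0 ≤ s → Continuous fun y => cone H s (y - x) - 2 * t * s := fun s hs =>
    ((continuous_cone hK hzero hs).comp (continuous_sub_right x)).sub continuous_const
  have hIo : IsOpen I := by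
    have : I = ⋃ s : {s : ℝ // 0 ≤ s ∧ s < k},
        {y | cone H k (y - x) - 2 * t * k < cone H s (y - x) - 2 * t * s} := by
      ext y
      simp [hI, and_assoc]
    rw [this]
    exact isOpen_iUnion fun s => isOpen_lt (hcc k hk0) (hcc s s.2.1)
  have hconc : ∀ s r, 0 ≤ s → s < k → k ≤ r → ∀ d,
      (r - k) * cone H s d + (k - s) * cone H r d ≤ (r - s) * cone H k d := by
    intro s r hs hsk hkr d
    have hrs : 0 < r - s := by linarith
    have h := cone_concave hK hzero hconv hs (hk0.trans hkr) (a := (r - k) / (r - s))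
      (b := (k - s) / (r - s)) (div_nonneg (by linarith) hrs.le) (div_nonneg (by linarith) hrs.le)
      (by field_simp; ring) d
    rw [show (r - k) / (r - s) * s + (k - s) / (r - s) * r = k by field_simp; ring] at h
    calc (r - k) * cone H s d + (k - s) * cone H r d
        = (r - s) * ((r - k) / (r - s) * cone H s d + (k - s) / (r - s) * cone H r d) := by
          field_simp
      _ ≤ _ := by gcongr
  -- A unit neighbourhood of `{H ≤ k}` lies in `{H ≤ S}`, so the level-`S` cone exceeds the
  -- level-`k` cone by `‖d‖`. Concavity in the level then bounds `‖d‖`.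
  have hIball : I ⊆ Metric.closedBall x (2 * t * S) := by
    rintro y ⟨s, hs, hsk, hlt⟩
    set d := y - x with hd
    rw [mem_closedBall_iff_norm, ← hd]
    have h1 : cone H k d + ‖d‖ ≤ cone H S d := by
      obtain ⟨p, hp, h⟩ := exists_cone_eq hK hzero hk0 d
      have h2 := inner_le_cone hK (hS p (‖d‖⁻¹ • d) (hp.trans hkk₀)
        (by rw [norm_smul, norm_inv, norm_norm]; exact inv_mul_le_one)) d
      rw [inner_add_left, real_inner_smul_left, real_inner_self_eq_norm_sq] at h2
      have h3 : ‖d‖⁻¹ * ‖d‖ ^ 2 = ‖d‖ := by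
        by_cases hw : ‖d‖ = 0
        · simp [hw]
        · field_simp
      linarith
    have h2 := hconc s S hs hsk hkS d
    have h3 : (k - s) * ‖d‖ ≤ (k - s) * (2 * t * (S - k)) := by
      nlinarith [mul_le_mul_of_nonneg_left h1 (sub_nonneg.2 hsk.le),
        mul_le_mul_of_nonneg_left hlt.le (sub_nonneg.2 hkS)]
    have h4 := le_of_mul_le_mul_left h3 (by linarith)
    nlinarith [mul_nonneg ht.le hk0]
  have hclI : closure I ⊆ Metric.closedBall x (2 * t * S) :=
    closure_minimal hIball Metric.isClosed_closedBall
  have hclR : closure I ⊆ Metric.closedBall x R :=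
    hclI.trans (Metric.closedBall_subset_closedBall hSR)
  have hIU : CompactlyInside I U :=
    ⟨hIo, (isCompact_closedBall x _).of_isClosed_subset isClosed_closure hclI, hclR.trans hRU⟩
  -- If a lower level beats `k`, concavity prevents higher ones from doing so. On the frontier of
  -- `I` level `k` is therefore optimal.
  have hright : ∀ y ∈ closure I, ∀ s, k ≤ s →
      cone H s (y - x) - 2 * t * s ≤ cone H k (y - x) - 2 * t * k := by
    intro y hy s hks
    have hcl : IsClosed {y | cone H s (y - x) - 2 * t * s ≤ cone H k (y - x) - 2 * t * k} :=
      isClosed_le (hcc s (hk0.trans hks)) (hcc k hk0)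
    refine closure_minimal (fun y hy => ?_) hcl hy
    obtain ⟨r, hr, hrk, hlt⟩ := hy
    have h2 := hconc r s hr hrk hks (y - x)
    have h3 : (k - r) * (cone H s (y - x) - 2 * t * s) ≤
        (k - r) * (cone H k (y - x) - 2 * t * k) := by
      nlinarith [mul_le_mul_of_nonneg_left hlt.le (sub_nonneg.2 hks)]
    exact le_of_mul_le_mul_left h3 (by linarith)
  have hleft : ∀ y ∉ I, ∀ s, 0 ≤ s → s < k →
      cone H s (y - x) - 2 * t * s ≤ cone H k (y - x) - 2 * t * k := fun y hy s hs hsk => by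
    by_contra! hlt
    exact hy ⟨s, hs, hsk, hlt⟩
  have hcone : ∀ y ∈ I, u y ≤ cone H k (y - x) + u x := by
    refine hu I hIU k hk0 x (u x) (fun y hy => ?_) fun _ => le_rfl
    rw [hIo.frontier_eq] at hy
    obtain ⟨s, hs0, hsS, hs⟩ := exists_cost_le hcont hK hzero hmin hS0 (2 * t) (y - x)
    have h1 : cone H s (y - x) - 2 * t * s ≤ cone H k (y - x) - 2 * t * k := by
      rcases lt_or_ge s k with h | h
      · exact hleft y hy.2 s hs0 h
      · exact hright y hy.1 s h
    linarith [hA y (hclR hy.1)]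
  intro y hy
  have hck := cone_sub_le_cost hcont hK hzero hk0 hkS ht.le (y - x)
  by_cases hyI : y ∈ I
  · linarith [hcone y hyI]
  · obtain ⟨s, hs0, hsS, hs⟩ := exists_cost_le hcont hK hzero hmin hS0 (2 * t) (y - x)
    have hAy := hA y hy
    rcases lt_or_ge s k with h | h
    · linarith [hleft y hyI s hs0 h]
    · have h1 := cone_sub_le_cost hcont hK hzero hs0 hsS ht.le (y - x)
      linarith [mul_le_mul_of_nonneg_left h ht.le]

/-- The sup-convolution of a subsolution is a discrete subsolution. -/
lemma ComparisonWithCones.loss_supConv_le_gain (hu : ComparisonWithCones H U u)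
    (hconv : ConvexOn ℝ univ H) (hcont : Continuous H) (hK : ∀ s, IsCompact (lev H s))
    (hzero : H 0 = 0) (hmin : ∀ p, 0 ≤ H p)
    {U₁ X D : Set (EuclideanSpace ℝ (Fin n))} {ρ : ℝ} (hρ : 0 < ρ) (hU₁ : U₁ ⊆ U)
    (hX : ∀ x ∈ X, Metric.closedBall x ρ ⊆ U₁) (hD : ∀ x ∈ D, Metric.closedBall x ρ ⊆ X)
    {B : ℝ} (hB : ∀ x ∈ U₁, |u x| ≤ B) {K : NNReal} (hLip : LipschitzOnWith K u U₁)
    {k₀ S t : ℝ} (hk₀ : ∀ p, ‖p‖ ≤ K → H p ≤ k₀) (hk₀S : k₀ ≤ S)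
    (hS : ∀ p q, H p ≤ k₀ → ‖q‖ ≤ 1 → H (p + q) ≤ S) (ht : 0 < t) (htS : t * S ≤ ρ)
    (x : X) (hx : x.1 ∈ D) :
    loss (fun x y : X => dist x.1 y.1 ≤ ρ) (fun x y => cost H S t (y.1 - x.1))
        (fun x => supConv (cost H S t) ρ u x) x ≤
      gain (fun x y : X => dist x.1 y.1 ≤ ρ) (fun x y => cost H S t (y.1 - x.1))
        (fun x => supConv (cost H S t) ρ u x) x := by
  have hk₀0 : 0 ≤ k₀ := hzero ▸ hk₀ 0 (by simp)
  have hS0 : 0 ≤ S := hk₀0.trans hk₀S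
  have hc0 := cost_nonneg hcont hK hzero hS0 t
  have hN : ∀ x : X, dist x.1 x.1 ≤ ρ := fun x => by simpa using hρ.le
  set f : X → ℝ := fun x => supConv (cost H S t) ρ u x with hf
  have hbd : ∀ y ∈ X, ∀ z ∈ Metric.closedBall y ρ, u z ≤ B := fun y hy z hz =>
    (le_abs_self _).trans (hB z (hX y hy hz))
  have hle : ∀ y : X, ∀ z ∈ Metric.closedBall y.1 ρ, u z - cost H S t (z - y.1) ≤ f y :=
    fun y z hz => le_supConv hc0 (hbd y y.2) hz
  have hself : ∀ y ∈ X, y ∈ U₁ := fun y hy => hX y hy (Metric.mem_closedBall_self hρ.le)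
  have hfB : ∀ y, |f y| ≤ B := fun y => abs_le.2
    ⟨by
      have h1 := hle y y (Metric.mem_closedBall_self hρ.le)
      rw [sub_self, cost_zero hcont hK hzero hmin hS0 ht.le] at h1
      linarith [(abs_le.1 (hB y (hself y y.2))).1],
     supConv_le hρ.le fun z hz => by linarith [hbd y y.2 z hz, hc0 (z - y)]⟩
  have hlip : ∀ y ∈ U₁, ∀ z ∈ U₁, u z - u y ≤ cost H S t (z - y) + t * k₀ := fun y hy z hz => by
    have h1 := hLip.dist_le_mul z hz y hy
    rw [Real.dist_eq, dist_eq_norm] at h1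
    exact (le_abs_self _).trans (h1.trans (mul_norm_le_cost hcont hK K.2 hk₀ hk₀S ht.le _))
  set G := gain (fun x y : X => dist x.1 y.1 ≤ ρ) (fun x y => cost H S t (y.1 - x.1)) f x with hG
  have hgain : ∀ y : X, dist x.1 y.1 ≤ ρ → f y - f x - cost H S t (y.1 - x.1) ≤ G :=
    fun y hy => le_gain (N := fun x y : X => dist x.1 y.1 ≤ ρ)
      (c := fun x y => cost H S t (y.1 - x.1)) (fun x y => hc0 _) hfB hy
  -- Go from `x` to `y` through the midpoint: the first half is bounded by the gain of `f`, the
  -- second by the definition of `f`, and the two costs add up to at most the cost at time `2t`.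
  have hmain : ∀ y ∈ Metric.closedBall x.1 (2 * ρ), y ∈ U₁ ∧
      u y ≤ G + f x + cost H S (2 * t) (y - x.1) := by
    intro y hy
    rw [mem_closedBall_iff_norm] at hy
    set w : EuclideanSpace ℝ (Fin n) := (2⁻¹ : ℝ) • (y - x.1) with hw
    have hwn : ‖w‖ ≤ ρ := by
      rw [hw, norm_smul, Real.norm_of_nonneg (by norm_num)]
      linarith
    have hm : x.1 + w ∈ Metric.closedBall x.1 ρ := by simpa [mem_closedBall_iff_norm] using hwn
    have hyw : y - (x.1 + w) = w := by simp only [hw]; module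
    have hym : y ∈ Metric.closedBall (x.1 + w) ρ := by rwa [mem_closedBall_iff_norm, hyw]
    have hmX := hD x hx hm
    refine ⟨hX _ hmX hym, ?_⟩
    have h1 := hle ⟨x.1 + w, hmX⟩ y hym
    have h2 := hgain ⟨x.1 + w, hmX⟩ (by simpa using hwn)
    have h3 := two_mul_cost_le hcont hK hzero hS0 t w
    rw [show (2 : ℝ) • w = y - x.1 by simp only [hw]; module] at h3
    simp only [hyw, add_sub_cancel_left] at h1 h2
    linarith
  have hcrit := hu.le_add_cost hconv hcont hK hzero hmin (x := x.1) (R := 2 * ρ)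
    (fun y hy => hU₁ (hmain y hy).1) ht (by linarith) hk₀S hS (A := G + f x - u x)
    (by
      have := (hmain x (Metric.mem_closedBall_self (by linarith))).2
      rw [sub_self, cost_zero hcont hK hzero hmin hS0 (by linarith)] at this
      linarith)
    (by
      have : G ≤ u x + 2 * t * k₀ - f x := gain_le hN fun y hy => by
        have h1 : f y ≤ u y + t * k₀ := supConv_le hρ.le fun z hz => by
          linarith [hlip y (hself y y.2) z (hX y y.2 hz)]
        linarith [hlip x (hself x x.2) y (hself y y.2)]
      linarith)
    (fun y hy => by linarith [(hmain y hy).2])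
  have hfx : f x ≤ u x + (G + f x - u x) / 2 := supConv_le hρ.le fun y hy => by
    linarith [hcrit y (Metric.closedBall_subset_closedBall (by linarith) hy)]
  refine (loss_le hN fun z hz => ?_ : _ ≤ f x - u x).trans (by linarith)
  linarith [hle z x (by simpa using hz)]

end ConvexityCriterion

/-! ### A cheap direction transversal to the zero set -/

section Directions

variable {E : Type*} [NormedAddCommGroup E] [InnerProductSpace ℝ E] [FiniteDimensional ℝ E]

/-- A convex set with empty interior containing the origin lies in a hyperplane. -/
lemma Convex.exists_unit_orthogonal {Z : Set E} (hZ : Convex ℝ Z) (h0 : (0 : E) ∈ Z)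
    (hint : interior Z = ∅) : ∃ e : E, ‖e‖ = 1 ∧ ∀ p ∈ Z, inner ℝ p e = 0 := by
  have hspan : Submodule.span ℝ Z ≠ ⊤ := fun h => by
    have haff : affineSpan ℝ Z = ⊤ := by
      rw [AffineSubspace.affineSpan_eq_top_iff_vectorSpan_eq_top_of_nonempty ℝ E E ⟨0, h0⟩,
        vectorSpan_eq_span_vsub_set_right ℝ h0]
      simpa using h
    have := hZ.interior_nonempty_iff_affineSpan_eq_top.2 haff
    simp [hint] at this
  have horth : (Submodule.span ℝ Z)ᗮ ≠ ⊥ := fun h => hspan (Submodule.orthogonal_eq_bot_iff.1 h)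
  obtain ⟨e, he, he0⟩ := Submodule.exists_mem_ne_zero_of_ne_bot horth
  refine ⟨‖e‖⁻¹ • e, by rw [norm_smul, norm_inv, norm_norm, inv_mul_cancel₀ (by simpa using he0)],
    fun p hp => ?_⟩
  rw [inner_smul_right, he p (Submodule.subset_span hp), mul_zero]

omit [FiniteDimensional ℝ E] in
-- On the compact part of `{H ≤ S}` where `|⟨p, e⟩| ≥ ε`, `H` has a positive minimum, so a large
-- multiple of `H` dominates there.
lemma exists_abs_inner_le {H : E → ℝ} (hcont : Continuous H) (hK : ∀ s, IsCompact (lev H s))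
    (hmin : ∀ p, 0 ≤ H p) {e : E} (he : ∀ p, H p = 0 → inner ℝ p e = 0) (S : ℝ) {ε : ℝ}
    (hε : 0 < ε) : ∃ M > 0, ∀ p, H p ≤ S → |inner ℝ p e| ≤ ε + M * H p := by
  have hcp : IsCompact (lev H S ∩ {p | ε ≤ |inner ℝ p e|}) :=
    (hK S).inter_right (isClosed_le continuous_const (by fun_prop))
  rcases (lev H S ∩ {p | ε ≤ |inner ℝ p e|}).eq_empty_or_nonempty with h | h
  · refine ⟨1, one_pos, fun p hp => ?_⟩
    have : ¬ ε ≤ |inner ℝ p e| := fun hcon => h.subset ⟨hp, hcon⟩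
    linarith [hmin p]
  · obtain ⟨p₀, hp₀, hp₀m⟩ := hcp.exists_isMinOn h hcont.continuousOn
    have hpos : 0 < H p₀ := lt_of_le_of_ne (hmin p₀) fun h0 => by
      have := hp₀.2
      simp only [mem_ofPred_eq, he p₀ h0.symm, abs_zero] at this
      linarith
    obtain ⟨R, hR⟩ := ((hK S).image (f := fun p => |inner ℝ p e|) (by fun_prop)).bddAbove
    refine ⟨(|R| + 1) / H p₀, by positivity, fun p hp => ?_⟩
    by_cases hpe : ε ≤ |inner ℝ p e|
    · have h1 : |inner ℝ p e| ≤ R := hR ⟨p, hp, rfl⟩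
      have h2 : H p₀ ≤ H p := hp₀m ⟨hp, hpe⟩
      have h3 : |R| + 1 ≤ (|R| + 1) / H p₀ * H p := by
        rw [div_mul_eq_mul_div, le_div_iff₀ hpos]
        gcongr
      linarith [le_abs_self R]
    · have : 0 ≤ (|R| + 1) / H p₀ * H p := mul_nonneg (by positivity) (hmin p)
      linarith

lemma exists_forall_norm_le_le {H : E → ℝ} (hcont : Continuous H) (K : ℝ) :
    ∃ k, ∀ p, ‖p‖ ≤ K → H p ≤ k := by
  obtain ⟨k, hk⟩ := ((isCompact_closedBall (0 : E) K).image hcont).bddAbove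
  exact ⟨k, fun p hp => hk ⟨p, by simpa using hp, rfl⟩⟩

end Directions

/-! ### The comparison theorem -/

section Comparison

variable {n : ℕ} {H : EuclideanSpace ℝ (Fin n) → ℝ} {U : Set (EuclideanSpace ℝ (Fin n))}
  {u v : EuclideanSpace ℝ (Fin n) → ℝ}

lemma ConvexOn.comp_neg_univ (hconv : ConvexOn ℝ univ H) :
    ConvexOn ℝ univ (fun p => H (-p)) := by
  simpa [Function.comp_def] using hconv.comp_linearMap (-LinearMap.id)

lemma isCompact_lev_comp_neg (hK : ∀ s, IsCompact (lev H s)) (s : ℝ) :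
    IsCompact (lev (fun p => H (-p)) s) :=
  (hK s).neg

lemma compactlyInside_infDist_gt (hUb : Bornology.IsBounded U) {r : ℝ} (hr : 0 < r) :
    CompactlyInside {x | r < Metric.infDist x Uᶜ} U := by
  have hcl : closure {x | r < Metric.infDist x Uᶜ} ⊆ {x | r ≤ Metric.infDist x Uᶜ} :=
    closure_minimal (fun x (hx : r < _) => hx.le)
      (isClosed_le continuous_const (Metric.continuous_infDist_pt _))
  have hsub : {x | r ≤ Metric.infDist x Uᶜ} ⊆ U := fun x hx => by
    by_contra hxU
    rw [mem_ofPred_eq, Metric.infDist_zero_of_mem hxU] at hx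
    linarith
  refine ⟨isOpen_lt continuous_const (Metric.continuous_infDist_pt _), ?_, hcl.trans hsub⟩
  exact Metric.isCompact_of_isClosed_isBounded isClosed_closure (hUb.subset (hcl.trans hsub))

lemma comparison_of_forall_frontier_le (hconv : ConvexOn ℝ univ H)
    (hzero : H 0 = 0) (hmin : ∀ p, 0 ≤ H p) (hbdd : Bornology.IsBounded {p | H p = 0})
    (hint : interior {p | H p = 0} = ∅) (hU : IsOpen U) (hUb : Bornology.IsBounded U)
    (hne : Uᶜ.Nonempty) (huc : ContinuousOn u (closure U)) (hvc : ContinuousOn v (closure U))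
    (hu : AbsSubminimizing H U u) (hv : AbsSuperminimizing H U v) {M : ℝ}
    (hM : ∀ y ∈ frontier U, u y - v y ≤ M) {x : EuclideanSpace ℝ (Fin n)} (hx : x ∈ U) :
    u x - v x ≤ M := by
  have hcont : Continuous H := continuousOn_univ.1 (hconv.continuousOn isOpen_univ)
  have hK := hconv.isCompact_lev hzero hmin hbdd
  have hclU : IsCompact (closure U) := hUb.isCompact_closure
  suffices h : ∀ ε > 0, u x - v x ≤ M + 4 * ε by
    refine le_of_forall_pos_le_add fun ε hε => ?_
    linarith [h (ε / 4) (by positivity)]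
  intro ε hε
  obtain ⟨r, hr, hrM⟩ : ∃ r > 0, ∀ y ∈ U, Metric.infDist y Uᶜ ≤ 3 * r → u y - v y ≤ M + ε := by
    have hQ : IsCompact (closure U ∩ {y | M + ε ≤ u y - v y}) := by
      obtain ⟨F, hF, hFe⟩ := (continuousOn_iff_isClosed.1 (huc.sub hvc)) (Ici (M + ε)) isClosed_Ici
      have : closure U ∩ {y | M + ε ≤ u y - v y} = closure U ∩ F := by
        rw [inter_comm, inter_comm _ F, ← hFe]
        rfl
      rw [this]
      exact hclU.inter_right hF
    obtain ⟨δ, hδ, hsub⟩ := hQ.exists_cthickening_subset_open hU fun y hy => by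
      by_contra hyU
      have := hM y (by rw [hU.frontier_eq]; exact ⟨hy.1, hyU⟩)
      linarith [show M + ε ≤ u y - v y from hy.2]
    refine ⟨δ / 4, by positivity, fun y hy hyd => ?_⟩
    by_contra! hlt
    obtain ⟨z, hz, hyz⟩ := (Metric.infDist_lt_iff hne).1 (show Metric.infDist y Uᶜ < δ by linarith)
    exact hz (hsub (Metric.mem_cthickening_of_dist_le z y δ _ ⟨subset_closure hy, hlt.le⟩
      (by rw [dist_comm]; exact hyz.le)))
  -- Nested layers leave room for two successive steps of length `ρ ≤ r`; outside `D` the boundary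
  -- estimate holds up to `ε`.
  set U₁ : Set (EuclideanSpace ℝ (Fin n)) := {y | r < Metric.infDist y Uᶜ} with hU₁
  set X : Set (EuclideanSpace ℝ (Fin n)) := {y | 2 * r < Metric.infDist y Uᶜ} with hX
  set D : Set (EuclideanSpace ℝ (Fin n)) := {y | 3 * r < Metric.infDist y Uᶜ} with hD
  have hU₁U : CompactlyInside U₁ U := compactlyInside_infDist_gt hUb hr
  have hsubU : U₁ ⊆ U := subset_closure.trans hU₁U.2.2
  obtain ⟨K, hKu, hKv⟩ : ∃ K : NNReal, LipschitzOnWith K u U₁ ∧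
      LipschitzOnWith K (fun y => -v y) U₁ := by
    obtain ⟨K₁, h₁⟩ := hu.1 U₁ hU₁U
    obtain ⟨K₂, h₂⟩ := hv.1.neg U₁ hU₁U
    exact ⟨max K₁ K₂, h₁.weaken (le_max_left _ _), h₂.weaken (le_max_right _ _)⟩
  obtain ⟨B, hBu, hBv⟩ : ∃ B, (∀ y ∈ U, |u y| ≤ B) ∧ ∀ y ∈ U, |v y| ≤ B := by
    obtain ⟨B₁, h₁⟩ := hclU.exists_bound_of_continuousOn huc
    obtain ⟨B₂, h₂⟩ := hclU.exists_bound_of_continuousOn hvc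
    exact ⟨max B₁ B₂, fun y hy => (h₁ y (subset_closure hy)).trans (le_max_left _ _),
      fun y hy => (h₂ y (subset_closure hy)).trans (le_max_right _ _)⟩
  obtain ⟨ρ, hρ, hρr, hρK⟩ : ∃ ρ > 0, ρ ≤ r ∧ K * ρ ≤ ε := by
    refine ⟨min r (ε / (K + 1)), by positivity, min_le_left _ _, ?_⟩
    calc (K : ℝ) * min r (ε / (K + 1)) ≤ (K + 1) * (ε / (K + 1)) := by
          gcongr
          · linarith
          · exact min_le_right _ _
      _ = ε := by field_simp
  obtain ⟨k₀, hk₀⟩ := exists_forall_norm_le_le hcont K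
  have hk₀0 : 0 ≤ k₀ := hzero ▸ hk₀ 0 (by simp)
  obtain ⟨S, hk₀S, hS⟩ : ∃ S, k₀ ≤ S ∧ ∀ p q, H p ≤ k₀ → ‖q‖ ≤ 1 → H (p + q) ≤ S := by
    obtain ⟨R, hR⟩ := (hK k₀).isBounded.exists_norm_le
    obtain ⟨S, hS⟩ := exists_forall_norm_le_le hcont (R + 1)
    exact ⟨max k₀ S, le_max_left _ _, fun p q hp hq => (hS _ ((norm_add_le _ _).trans
      (add_le_add (hR p hp) hq))).trans (le_max_right _ _)⟩
  have hS0 : 0 ≤ S := hk₀0.trans hk₀S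
  obtain ⟨t, ht, htS⟩ : ∃ t > 0, t * S ≤ ρ := by
    refine ⟨ρ / (S + 1), by positivity, ?_⟩
    rw [div_mul_eq_mul_div, div_le_iff₀ (by positivity)]
    nlinarith
  obtain ⟨R, hR0, hR⟩ : ∃ R > 0, ∀ y ∈ U, ‖y‖ ≤ R := by
    obtain ⟨R, hR⟩ := hUb.exists_norm_le
    exact ⟨|R| + 1, by positivity, fun y hy => (hR y hy).trans (by linarith [le_abs_self R])⟩
  have hZ : Convex ℝ {p | H p = 0} := by
    have : {p | H p = 0} = {p ∈ univ | H p ≤ 0} := by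
      ext p
      simp [le_antisymm_iff, hmin p]
    rw [this]
    exact hconv.convex_le 0
  obtain ⟨e, he1, he⟩ := hZ.exists_unit_orthogonal hzero hint
  -- There will be at most `2 * R / η` steps of round-trip cost `2 * η * ε'`, a total of `ε`.
  set ε' := ε / (4 * R) with hε'
  have hε'0 : 0 < ε' := by positivity
  obtain ⟨m, hm, hme⟩ := exists_abs_inner_le hcont hK hmin he S hε'0
  -- With `η * m ≤ t` the penalty `t * H p` absorbs `η * m * H p`, so a step of length `η` along
  -- `±e` costs at most `η * ε'`.
  obtain ⟨η, hη, hηρ, hηm⟩ : ∃ η > 0, η ≤ ρ ∧ η * m ≤ t := by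
    refine ⟨min ρ (t / m), by positivity, min_le_left _ _, ?_⟩
    calc min ρ (t / m) * m ≤ t / m * m := by
          gcongr
          exact min_le_right _ _
      _ = t := by field_simp
  have hstep : ∀ σ : ℝ, |σ| = 1 → cost H S t ((η * σ) • e) ≤ η * ε' := by
    intro σ hσ
    obtain ⟨p, hp, h⟩ := exists_cost_eq hcont hK hzero hS0 t ((η * σ) • e)
    rw [h, inner_smul_right]
    have h1 : σ * inner ℝ p e ≤ |inner ℝ p e| := by
      simpa [abs_mul, hσ] using le_abs_self (σ * inner ℝ p e)
    have h2 := mul_le_mul_of_nonneg_left (h1.trans (hme p hp)) hη.le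
    nlinarith [mul_le_mul_of_nonneg_right hηm (hmin p)]
  have hballX : ∀ y ∈ X, Metric.closedBall y ρ ⊆ U₁ := fun y (hy : 2 * r < _) z hz => by
    have h1 := Metric.infDist_le_infDist_add_dist (s := Uᶜ) (x := y) (y := z)
    rw [Metric.mem_closedBall, dist_comm] at hz
    exact (by linarith : r < Metric.infDist z Uᶜ)
  have hballD : ∀ y ∈ D, Metric.closedBall y ρ ⊆ X := fun y (hy : 3 * r < _) z hz => by
    have h1 := Metric.infDist_le_infDist_add_dist (s := Uᶜ) (x := y) (y := z)
    rw [Metric.mem_closedBall, dist_comm] at hz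
    exact (by linarith : 2 * r < Metric.infDist z Uᶜ)
  have hXU : ∀ y ∈ X, y ∈ U₁ := fun y hy => hballX y hy (Metric.mem_closedBall_self hρ.le)
  have hK' := isCompact_lev_comp_neg hK
  have hcont' : Continuous fun p => H (-p) := hcont.comp continuous_neg
  have hzero' : H (-0) = 0 := by simpa using hzero
  have hc0 := cost_nonneg hcont hK hzero hS0 t
  have hc0' := cost_nonneg hcont' hK' hzero' hS0 t
  set N : X → X → Prop := fun x y => dist x.1 y.1 ≤ ρ with hN
  set c : X → X → ℝ := fun x y => cost H S t (y.1 - x.1) with hc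
  set f : X → ℝ := fun y => supConv (cost H S t) ρ u y with hf
  set g' : X → ℝ := fun y => supConv (cost (fun p => H (-p)) S t) ρ (fun z => -v z) y with hg'
  have hloss : ∀ y : X, y.1 ∈ D → loss N c f y ≤ gain N c f y :=
    (hu.comparisonWithCones hU hK hzero).loss_supConv_le_gain hconv hcont hK hzero hmin hρ hsubU
      hballX hballD (fun y hy => hBu y (hsubU hy)) hKu hk₀ hk₀S hS ht htS
  have hloss' : ∀ y : X, y.1 ∈ D → gain N c (fun y => -g' y) y ≤ loss N c (fun y => -g' y) y := by
    intro y hy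
    have := (hv.neg.comparisonWithCones hU hK' hzero').loss_supConv_le_gain hconv.comp_neg_univ
      hcont' hK' hzero' (fun p => hmin _) hρ hsubU hballX hballD (B := B)
      (fun y hy => by simpa using hBv y (hsubU hy)) hKv (fun p hp => hk₀ _ (by simpa using hp)) hk₀S
      (fun p q hp hq => by rw [neg_add]; exact hS _ _ hp (by simpa using hq)) ht htS y hy
    simpa [loss, cost_comp_neg, neg_sub, hg', hc] using this
  have hfu : ∀ y : X, u y ≤ f y ∧ f y ≤ u y + ε ∧ f y ≤ B := fun y => by
    have hball := hballX y y.2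
    refine ⟨?_, supConv_le hρ.le fun z hz => ?_, supConv_le hρ.le fun z hz => ?_⟩
    · have := le_supConv hc0 (fun z hz => (le_abs_self _).trans (hBu z (hsubU (hball hz))))
        (Metric.mem_closedBall_self (x := y.1) hρ.le)
      rwa [sub_self, cost_zero hcont hK hzero hmin hS0 ht.le, sub_zero] at this
    · have h1 := (le_abs_self _).trans (hKu.dist_le_mul z (hball hz) y (hXU y y.2))
      have h2 : (K : ℝ) * dist z y ≤ K * ρ := by gcongr; exact hz
      linarith [hc0 (z - y)]
    · linarith [hc0 (z - y), (abs_le.1 (hBu z (hsubU (hball hz)))).2]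
  have hgv : ∀ y : X, -v y ≤ g' y ∧ g' y ≤ -v y + ε ∧ g' y ≤ B := fun y => by
    have hball := hballX y y.2
    refine ⟨?_, supConv_le hρ.le fun z hz => ?_, supConv_le hρ.le fun z hz => ?_⟩
    · have := le_supConv (u := fun z => -v z) hc0'
        (fun z hz => (neg_le_abs _).trans (hBv z (hsubU (hball hz))))
        (Metric.mem_closedBall_self (x := y.1) hρ.le)
      rwa [sub_self, cost_zero hcont' hK' hzero' (fun p => hmin _) hS0 ht.le, sub_zero] at this
    · have h1 := (le_abs_self _).trans (hKv.dist_le_mul z (hball hz) y (hXU y y.2))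
      have h2 : (K : ℝ) * dist z y ≤ K * ρ := by gcongr; exact hz
      linarith [hc0' (z - y)]
    · linarith [hc0' (z - y), (abs_le.1 (hBv z (hsubU (hball hz)))).1]
  by_cases hxX : x ∈ X
  swap
  · have : Metric.infDist x Uᶜ ≤ 2 * r := not_lt.1 hxX
    linarith [hrM x hx (by linarith)]
  have hinner : ∀ y ∈ U, |inner ℝ y e| ≤ R := fun y hy =>
    (abs_real_inner_le_norm y e).trans (by rw [he1, mul_one]; exact hR y hy)
  have hmain := discrete_comparison (N := N) (c := c) (f := f) (g := fun y => -g' y) (B := B)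
    (D := {y : X | y.1 ∈ D}) (κ := 2 * (η * ε'))
    (fun y => by simpa [hN] using hρ.le) (fun y z h => by simpa only [hN, dist_comm] using h)
    (fun y z => hc0 _)
    (fun y => abs_le.2 ⟨by linarith [(abs_le.1 (hBu y (hsubU (hXU y y.2)))).1, (hfu y).1],
      (hfu y).2.2⟩)
    (fun y => by
      rw [abs_neg]
      exact abs_le.2 ⟨by linarith [(abs_le.1 (hBv y (hsubU (hXU y y.2)))).2, (hgv y).1],
        (hgv y).2.2⟩)
    -- The rank counts the `η`-steps left in direction `e` before the bound `R` on the coordinate is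
    -- reached; adding `η • e` lowers it by exactly one.
    hloss hloss' (by positivity) (fun y => ⌊(R - inner ℝ y.1 e) / η⌋₊) (J := ⌊2 * R / η⌋₊)
    (fun y => Nat.floor_le_floor (by
      have := (abs_le.1 (hinner y (hsubU (hXU y y.2)))).1
      gcongr
      linarith))
    (fun y hy => by
      have hz : y.1 + η • e ∈ Metric.closedBall y.1 ρ := by
        simpa [mem_closedBall_iff_norm, norm_smul, he1, abs_of_pos hη] using hηρ
      have hzX := hballD y hy hz
      refine ⟨⟨y.1 + η • e, hzX⟩, (dist_comm _ _).trans_le hz, ?_, ?_⟩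
      · have h1 := (abs_le.1 (hinner _ (hsubU (hXU _ hzX)))).2
        have h2 : inner ℝ (y.1 + η • e) e = inner ℝ y.1 e + η := by
          rw [inner_add_left, real_inner_smul_left, real_inner_self_eq_norm_sq, he1]
          ring
        have h3 : (R - inner ℝ (y.1 + η • e) e) / η = (R - inner ℝ y.1 e) / η - 1 := by
          rw [h2]
          field_simp
          ring
        have h4 : 0 ≤ (R - inner ℝ (y.1 + η • e) e) / η := div_nonneg (by linarith) hη.le
        have h5 : 1 ≤ ⌊(R - inner ℝ y.1 e) / η⌋₊ := Nat.le_floor (by push_cast; linarith)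
        simp only [h3, Nat.floor_sub_one]
        omega
      · have h1 := hstep 1 (by simp)
        have h2 := hstep (-1) (by simp)
        have h3 : y.1 + η • e - y.1 = (η * 1) • e := by module
        have h4 : y.1 - (y.1 + η • e) = (η * -1) • e := by module
        simp only [hc, h3, h4]
        linarith)
    (M := M + 3 * ε)
    (fun y hy => by
      have h1 := hrM y (hsubU (hXU y y.2)) (not_lt.1 hy)
      linarith [(hfu y).2.1, (hgv y).2.1])
    ⟨x, hxX⟩
  have hJ : (⌊2 * R / η⌋₊ : ℝ) * (2 * (η * ε')) ≤ ε := by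
    calc (⌊2 * R / η⌋₊ : ℝ) * (2 * (η * ε')) ≤ 2 * R / η * (2 * (η * ε')) := by
          gcongr
          exact Nat.floor_le (by positivity)
      _ = ε := by
          rw [hε']
          field_simp
          ring
  have h1 := (hfu ⟨x, hxX⟩).1
  have h2 := (hgv ⟨x, hxX⟩).1
  simp only at h1 h2
  linarith

end Comparison

end

theorem theorem2p1 (n : ℕ) (H : EuclideanSpace ℝ (Fin n) → ℝ)
    (hconv : ConvexOn ℝ Set.univ H)
    (hzero : H 0 = 0) (hmin : ∀ p, 0 ≤ H p)
    (hbdd : Bornology.IsBounded {p | H p = 0})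
    (hint : interior {p | H p = 0} = ∅)
    (U : Set (EuclideanSpace ℝ (Fin n))) (hU : IsOpen U) (hUb : Bornology.IsBounded U) :
    (∀ u v : EuclideanSpace ℝ (Fin n) → ℝ,
      ContinuousOn u (closure U) → ContinuousOn v (closure U) →
      AbsSubminimizing H U u → AbsSuperminimizing H U v →
      ∀ x ∈ U, ∃ y ∈ frontier U,
        IsMaxOn (fun z => u z - v z) (frontier U) y ∧ u x - v x ≤ u y - v y) ∧
    (∀ u v : EuclideanSpace ℝ (Fin n) → ℝ,
      ContinuousOn u (closure U) → ContinuousOn v (closure U) →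
      AbsMinimizing H U u → AbsMinimizing H U v →
      Set.EqOn u v (frontier U) → Set.EqOn u v (closure U)) := by
  -- A bounded `U` equal to the whole space forces dimension zero, where `{H = 0}` is the whole
  -- space and has nonempty interior.
  have hUne : U ≠ univ := fun h => by
    have hcpt : IsCompact (univ : Set (EuclideanSpace ℝ (Fin n))) := by
      have := hUb.isCompact_closure
      rwa [h, closure_univ] at this
    have hsub : ∀ p : EuclideanSpace ℝ (Fin n), p = 0 := fun p => by
      by_contra hp
      have : Nontrivial (EuclideanSpace ℝ (Fin n)) := ⟨p, 0, hp⟩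
      have := NormedSpace.noncompactSpace ℝ (EuclideanSpace ℝ (Fin n))
      exact noncompact_univ _ hcpt
    have : {p | H p = 0} = univ := eq_univ_of_forall fun p => by rw [hsub p]; exact hzero
    rw [this, interior_univ] at hint
    exact univ_nonempty.ne_empty hint
  have hne : Uᶜ.Nonempty := nonempty_compl.2 hUne
  refine ⟨fun u v huc hvc hu hv x hx => ?_, fun u v huc hvc hu hv huv => ?_⟩
  · have hfr : (frontier U).Nonempty := nonempty_frontier_iff.2 ⟨⟨x, hx⟩, hUne⟩
    have hfc : IsCompact (frontier U) :=
      hUb.isCompact_closure.of_isClosed_subset isClosed_frontier frontier_subset_closure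
    obtain ⟨y, hy, hmax⟩ := hfc.exists_isMaxOn hfr ((huc.sub hvc).mono frontier_subset_closure)
    exact ⟨y, hy, hmax, comparison_of_forall_frontier_le hconv hzero hmin hbdd hint hU hUb hne
      huc hvc hu hv (fun z hz => hmax hz) hx⟩
  · intro x hx
    by_cases hxU : x ∈ U
    · have h1 := comparison_of_forall_frontier_le hconv hzero hmin hbdd hint hU hUb hne huc hvc
        hu.absSubminimizing hv.absSuperminimizing (M := 0) (fun y hy => by simp [huv hy]) hxU
      have h2 := comparison_of_forall_frontier_le hconv hzero hmin hbdd hint hU hUb hne hvc huc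
        hv.absSubminimizing hu.absSuperminimizing (M := 0) (fun y hy => by simp [huv hy]) hxU
      linarith
    · exact huv (by rw [hU.frontier_eq]; exact ⟨hx, hxU⟩)
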